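/- Let $h:\mathbb{R}\times\mathbb{R}\to\mathbb{R}$ be $C^2$ with $h(x+1,x'+1)=h(x,x')$ and $h_{12}\le -c$ everywhere for some constant $c>0$ (subscripts denote partial derivatives). For a tilt $F$ put $h_F(x,x')=h(x,x')-Fx$ and consider the gradient flow $$\dot x_n=-h_2(x_{n-1},x_n)-h_1(x_n,x_{n+1})+F,\qquad n\in\mathbb{Z},$$ whose equilibria are the configurations $\mathbf{x}=(x_n)_{n\in\mathbb{Z}}$ with $h_2(x_{n-1},x_n)+h_1(x_n,x_{n+1})=F$ for all $n$. Order configurations pointwise ($\mathbf{x}<\mathbf{y}$ means $x_n\le y_n$ for all $n$ and $\mathbf{x}\ne\mathbf{y}$), and let $(T_{qp}\mathbf{x})_n=x_{n-q}+p$ for $p,q\in\mathbb{Z}$. A configuration is Birkhoff if the set of its translates $T_{qp}\mathbf{x}$ is totally ordered; it is of type $(p,q)$ if $T_{qp}\mathbf{x}=\mathbf{x}$; it has mean spacing $\omega$ if $(x_n-x_0)/n\to\omega$ as $n\to\pm\infty$. Let $\mathcal{X}$ be the space of configurations with norm $\sum_n 2^{-|n|}|x_n|<\infty$. Depinning force: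 for $\omega\in\mathbb{R}$ and $F\ge 0$, all (bounded-spacing) solutions starting at a configuration of width at most $1$ with $x_n-n\omega$ bounded have the same average velocity $$\bar\nu(\omega,F)=\lim_{m-k\to\infty,\;t\to+\infty}\frac1{t(m-k)}\int_0^t\sum_{n=k}^{m-1}\dot x_n(s)\,ds ,$$ where the width of $\mathbf{x}$ is $\sup_m\big(\min\{n: T_{mn}\mathbf{x}\ge\mathbf{x}\}-\max\{n: T_{mn}\mathbf{x}\le\mathbf{x}\}\big)$. Put $F_d(\omega)=\sup\{F\ge 0:\bar\nu(\omega,F)=0\}$ and $F_d(p/q+)=\limsup_{\omega\searrow p/q}F_d(\omega)$ (which is in fact a limit). An ordered circle is the image $\ell$ of a continuous $\tau:\mathbb{R}\to\mathcal{X}$ with $\tau(s_1)<\tau(s_2)$ for $s_1<s_2$ and $\tau(s+1)=\tau(s)+\mathbf{1}$. An invariant ordered circle (IOC) for $F$ is an ordered circle invariant under all translations $T_{qp}$ and under the gradient flow for all $t\in\mathbb{R}$. It is of type $p/q+$ if every $\mathbf{x}\in\ell$ has mean spacing $p/q$ and satisfies $T_{qp}\mathbf{x}\le\mathbf{x}$,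 and $T_{qp}\mathbf{x}\ne\mathbf{x}$ for some $\mathbf{x}\in\ell$. An equilibrium of type $p/q+$ is a Birkhoff equilibrium $\mathbf{x}$ for which there are Birkhoff equilibria $\mathbf{x}^-<\mathbf{x}<\mathbf{x}^+$ of type $(p,q)$ with $|x_n-x_n^-|\to0$ as $n\to-\infty$ and $|x_n-x_n^+|\to0$ as $n\to+\infty$. For an equilibrium $\mathbf{x}^*$ and integers $l<m-1$, let $$W^*_{l,m}(y_{l+1},\dots,y_{m-1})=h_F(x^*_l,y_{l+1})+\sum_{i=l+1}^{m-2}h_F(y_i,y_{i+1})+h_F(y_{m-1},x^*_m);$$ $\mathbf{x}^*$ has positive Morse index from $l$ to $m$ if the matrix $-D^2W^*_{l,m}$ at $(x^*_{l+1},\dots,x^*_{m-1})$ has at least one positive eigenvalue. **Theorem.** Let $p\in\mathbb{Z}$ and $q\ge1$ be coprime, let $F_d(p/q+)\le F<F_d(p/q)$, and let $\ell_F$ be an IOC of type $p/q+$ for $F$ such that every $\mathbf{z}\in\ell_F$ satisfies $\dot z_n=-h_2(z_{n-1},z_n)-h_1(z_n,z_{n+1})+F\ge0$ for all $n$. Then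 there are no equilibrium $\mathbf{x}^*\in\ell_F$ of type $p/q+$ and integers $l<m-1$ such that $\mathbf{x}^*$ has positive Morse index from $l$ to $m$. -/

import Mathlib

open Filter Topology

noncomputable section

namespace FK

/-! ### The energy and the gradient vector field -/

/-- `h₁`: partial derivative with respect to the first argument. -/
def d1 (h : ℝ → ℝ → ℝ) (x x' : ℝ) : ℝ := deriv (fun u => h u x') x

/-- `h₂`: partial derivative with respect to the second argument. -/
def d2 (h : ℝ → ℝ → ℝ) (x x' : ℝ) : ℝ := deriv (fun v => h x v) x'

/-- `h₁₂`: the mixed second partial derivative. -/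
def d12 (h : ℝ → ℝ → ℝ) (x x' : ℝ) : ℝ := deriv (fun v => d1 h x v) x'

/-- The standing assumptions on the nearest-neighbour energy `h`: it is `C²`, diagonally periodic,
and its mixed second derivative is bounded above by a negative constant. -/
structure IsEnergy (h : ℝ → ℝ → ℝ) : Prop where
  contDiff : ContDiff ℝ 2 (Function.uncurry h)
  periodic : ∀ x x', h (x + 1) (x' + 1) = h x x'
  twist : ∃ c : ℝ, 0 < c ∧ ∀ x x', d12 h x x' ≤ -c

/-- The tilted energy `h_F(x, x') = h(x, x') - F x`. -/
def tilted (h : ℝ → ℝ → ℝ) (F : ℝ) (x x' : ℝ) : ℝ := h x x' - F * x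

/-- The gradient vector field of the tilted chain:
`ẋ_n = -h₂(x_{n-1}, x_n) - h₁(x_n, x_{n+1}) + F`. -/
def vectorField (h : ℝ → ℝ → ℝ) (F : ℝ) (x : ℤ → ℝ) (n : ℤ) : ℝ :=
  -d2 h (x (n - 1)) (x n) - d1 h (x n) (x (n + 1)) + F

/-- Equilibria of the tilted chain. -/
def IsEquilibrium (h : ℝ → ℝ → ℝ) (F : ℝ) (x : ℤ → ℝ) : Prop :=
  ∀ n : ℤ, d2 h (x (n - 1)) (x n) + d1 h (x n) (x (n + 1)) = F

/-! ### Configurations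

Configurations are elements of `ℤ → ℝ`; the order on them is the pointwise partial order, and
`x < y` means `x ≤ y` and `x ≠ y`. -/

/-- The translation `(T_{qp} x)_n = x_{n-q} + p`. -/
def translate (q p : ℤ) (x : ℤ → ℝ) : ℤ → ℝ := fun n => x (n - q) + p

/-- Birkhoff configurations: the set of translates is totally ordered. -/
def IsBirkhoff (x : ℤ → ℝ) : Prop :=
  IsChain (· ≤ ·) {y : ℤ → ℝ | ∃ q p : ℤ, y = translate q p x}

/-- Configurations of type `(p, q)`. -/
def IsPeriodicType (p q : ℤ) (x : ℤ → ℝ) : Prop := translate q p x = x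

/-- Mean spacing: `ω = lim_{n → ±∞} (x_n - x_0) / n`. -/
def HasMeanSpacing (x : ℤ → ℝ) (ω : ℝ) : Prop :=
  Tendsto (fun n : ℤ => (x n - x 0) / (n : ℝ)) atTop (𝓝 ω) ∧
    Tendsto (fun n : ℤ => (x n - x 0) / (n : ℝ)) atBot (𝓝 ω)

/-- The terms of the weighted norm `‖x‖ = ∑ 2^{-|n|} |x_n|`. -/
def weightedTerm (x : ℤ → ℝ) (n : ℤ) : ℝ := (1 / 2 : ℝ) ^ n.natAbs * |x n|

/-- The weighted norm. -/
def weightedNorm (x : ℤ → ℝ) : ℝ := ∑' n : ℤ, weightedTerm x n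

/-- The space `𝒳` of sequences with finite weighted norm. -/
def X : Set (ℤ → ℝ) := {x | Summable (weightedTerm x)}

/-- Sequences of `𝒳` with spacings between `M` and `N`. -/
def XMN (M N : ℤ) : Set (ℤ → ℝ) :=
  {x | x ∈ X ∧ ∀ n : ℤ, (M : ℝ) ≤ x (n + 1) - x n ∧ x (n + 1) - x n ≤ N}

/-- `n⁻(m) = max {n | T_{mn} x ≤ x}`. -/
def nMinus (x : ℤ → ℝ) (m : ℤ) : ℤ := sSup {n : ℤ | translate m n x ≤ x}

/-- `n⁺(m) = min {n | T_{mn} x ≥ x}`. -/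
def nPlus (x : ℤ → ℝ) (m : ℤ) : ℤ := sInf {n : ℤ | x ≤ translate m n x}

/-- The width `sup_m (n⁺(m) - n⁻(m))`. -/
def width (x : ℤ → ℝ) : EReal := ⨆ m : ℤ, (((nPlus x m - nMinus x m : ℤ) : ℝ) : EReal)

/-- The space `𝒳_ω` of sequences for which `x_n - n ω` is bounded. -/
def Xω (ω : ℝ) : Set (ℤ → ℝ) := {x | x ∈ X ∧ ∃ C : ℝ, ∀ n : ℤ, |x n - n * ω| ≤ C}

/-- The set `𝒳_ω¹` of sequences of `𝒳_ω` of width at most one. (On `𝒳_ω` the maxima and minima in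
the definition of the width exist.) -/
def XωOne (ω : ℝ) : Set (ℤ → ℝ) := {x | x ∈ Xω ω ∧ width x ≤ 1}

/-! ### The depinning force -/

/-- Forward solutions `y(t)`, `t ≥ 0`, of the gradient flow which stay in some `𝒳_{MN}`; the spacing
bound makes the solution unique, also when `h` has unbounded second derivatives. For an
initial value in `𝒳_ω¹` there is exactly one such solution. -/
def IsForwardSolution (h : ℝ → ℝ → ℝ) (F : ℝ) (y : ℝ → ℤ → ℝ) : Prop :=
  (∀ t : ℝ, 0 ≤ t → ∀ n : ℤ,
    HasDerivWithinAt (fun s => y s n) (vectorField h F (y t) n) (Set.Ici 0) t) ∧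
  ∃ M N : ℤ, ∀ t : ℝ, 0 ≤ t → y t ∈ XMN M N

/-- `v` is the average velocity of `y`: the limit, as `m - k → ∞` and `t → +∞`, of
`1/(t(m-k)) ∫_0^t ∑_{n=k}^{m-1} ẏ_n(s) ds`. -/
def HasAverageVelocity (h : ℝ → ℝ → ℝ) (F : ℝ) (y : ℝ → ℤ → ℝ) (v : ℝ) : Prop :=
  Tendsto
    (fun a : (ℤ × ℤ) × ℝ =>
      1 / (a.2 * ((a.1.2 - a.1.1 : ℤ) : ℝ)) *
        ∫ s in (0 : ℝ)..a.2, ∑ n ∈ Finset.Ico a.1.1 a.1.2, vectorField h F (y s) n)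
    (comap (fun a : (ℤ × ℤ) × ℝ => a.1.2 - a.1.1) atTop ⊓
      comap (fun a : (ℤ × ℤ) × ℝ => a.2) atTop)
    (𝓝 v)

/-- `ν̄(ω, F) = v`: the common average velocity of all solutions starting in `𝒳_ω¹`. -/
def AverageVelocityEq (h : ℝ → ℝ → ℝ) (ω F v : ℝ) : Prop :=
  ∀ y : ℝ → ℤ → ℝ, IsForwardSolution h F y → y 0 ∈ XωOne ω → HasAverageVelocity h F y v

/-- The depinning force `F_d(ω) = sup {F ≥ 0 | ν̄(ω, F) = 0}`. -/
def depinningForce (h : ℝ → ℝ → ℝ) (ω : ℝ) : ℝ :=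
  sSup {F : ℝ | 0 ≤ F ∧ AverageVelocityEq h ω F 0}

/-- `F_d(r+)`, the (upper) limit of `F_d(ω)` as `ω` decreases to `r`. -/
def depinningForcePlus (h : ℝ → ℝ → ℝ) (r : ℝ) : ℝ :=
  limsup (depinningForce h) (𝓝[>] r)

/-! ### Invariant ordered circles -/

/-- Ordered circles: images of strictly increasing maps `τ : ℝ → 𝒳`, continuous for the weighted
norm, with `τ(s + 1) = τ(s) + 𝟏`. -/
def IsOrderedCircle (ℓ : Set (ℤ → ℝ)) : Prop :=
  ∃ τ : ℝ → ℤ → ℝ,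
    (∀ s, τ s ∈ X) ∧
    (∀ s, Tendsto (fun s' => weightedNorm (τ s' - τ s)) (𝓝 s) (𝓝 0)) ∧
    (∀ s₁ s₂, s₁ < s₂ → τ s₁ < τ s₂) ∧
    (∀ s, τ (s + 1) = τ s + 1) ∧
    Set.range τ = ℓ

/-- Translation-invariant ordered circles. -/
def IsTOC (ℓ : Set (ℤ → ℝ)) : Prop :=
  IsOrderedCircle ℓ ∧ ∀ q p : ℤ, translate q p '' ℓ = ℓ

/-- Solutions of the gradient flow for all times. -/
def IsSolution (h : ℝ → ℝ → ℝ) (F : ℝ) (y : ℝ → ℤ → ℝ) : Prop :=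
  ∀ (t : ℝ) (n : ℤ), HasDerivAt (fun s => y s n) (vectorField h F (y t) n) t

/-- Invariant ordered circles: the solution through each point of `ℓ` exists for all `t ∈ ℝ` and
stays in `ℓ`. (The elements of a translation-invariant ordered circle have uniformly bounded
spacings, so there is only one solution that stays in `ℓ`.) -/
def IsIOC (h : ℝ → ℝ → ℝ) (F : ℝ) (ℓ : Set (ℤ → ℝ)) : Prop :=
  IsTOC ℓ ∧ ∀ x ∈ ℓ, ∃ y : ℝ → ℤ → ℝ, y 0 = x ∧ IsSolution h F y ∧ ∀ t, y t ∈ ℓ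

/-- Invariant ordered circles of type `p/q+`. -/
def IsIOCPlus (h : ℝ → ℝ → ℝ) (F : ℝ) (p : ℤ) (q : ℕ) (ℓ : Set (ℤ → ℝ)) : Prop :=
  IsIOC h F ℓ ∧
    (∀ x ∈ ℓ, HasMeanSpacing x ((p : ℝ) / q) ∧ translate q p x ≤ x) ∧
    ∃ x ∈ ℓ, translate q p x ≠ x

/-- Equilibria of type `p/q+`, i.e. equilibrium advancing discommensurations: Birkhoff equilibria
`x⁻ < x < x⁺` with `x⁻, x⁺` of type `(p, q)`, left-asymptotic to `x⁻` and right-asymptotic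
to `x⁺`. -/
def IsEquilibriumPlus (h : ℝ → ℝ → ℝ) (F : ℝ) (p : ℤ) (q : ℕ) (x : ℤ → ℝ) : Prop :=
  IsBirkhoff x ∧ IsEquilibrium h F x ∧
    ∃ xm xp : ℤ → ℝ,
      (IsBirkhoff xm ∧ IsEquilibrium h F xm ∧ IsPeriodicType p q xm) ∧
      (IsBirkhoff xp ∧ IsEquilibrium h F xp ∧ IsPeriodicType p q xp) ∧
      xm < x ∧ x < xp ∧
      Tendsto (fun n : ℤ => |x n - xm n|) atBot (𝓝 0) ∧
      Tendsto (fun n : ℤ => |x n - xp n|) atTop (𝓝 0)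

/-! ### Truncated energies and their Morse index -/

/-- The configuration which equals `y` at the sites strictly between `l` and `m` and `x`
elsewhere. -/
def glue (x : ℤ → ℝ) (l m : ℤ) (y : ↥(Finset.Ioo l m) → ℝ) (i : ℤ) : ℝ :=
  if hi : i ∈ Finset.Ioo l m then y ⟨i, hi⟩ else x i

/-- The truncated energy with end points fixed at `x_l` and `x_m`:
`h_F(x_l, y_{l+1}) + ∑_{i=l+1}^{m-2} h_F(y_i, y_{i+1}) + h_F(y_{m-1}, x_m)`. -/
def truncatedEnergy (h : ℝ → ℝ → ℝ) (F : ℝ) (x : ℤ → ℝ) (l m : ℤ)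
    (y : ↥(Finset.Ioo l m) → ℝ) : ℝ :=
  ∑ i ∈ Finset.Ico l m, tilted h F (glue x l m y i) (glue x l m y (i + 1))

/-- The Hessian matrix of a function of finitely many real variables. -/
def hessian {ι : Type} [Fintype ι] [DecidableEq ι] (W : (ι → ℝ) → ℝ) (y : ι → ℝ) :
    Matrix ι ι ℝ :=
  Matrix.of fun i j =>
    fderiv ℝ (fun z => fderiv ℝ W z (Pi.single j (1 : ℝ))) y (Pi.single i (1 : ℝ))

/-- `x` has positive Morse index from `l` to `m`: the matrix `-D²W_{l,m}` at
`(x_{l+1}, …, x_{m-1})` has a positive eigenvalue. -/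
def HasPositiveMorseIndex (h : ℝ → ℝ → ℝ) (F : ℝ) (x : ℤ → ℝ) (l m : ℤ) : Prop :=
  ∃ μ : ℝ, 0 < μ ∧
    Module.End.HasEigenvalue
      (Matrix.toLin' (-hessian (truncatedEnergy h F x l m) (fun i => x i))) μ

end FK

end

/-!
The gradient vector field is cooperative: since `h₁₂ < 0`, its value at a site increases with the
positions of the two neighbours. Hence `-D²W*` has nonnegative off-diagonal entries, and if `u` is
an eigenvector for a positive eigenvalue, then `v = |u|` satisfies `-D²W* v > 0` on the support of
`v`. For small `ε > 0` the configuration `x* - ε v` therefore moves strictly down on that support.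
A configuration of the circle slightly below `x*` lies strictly below it at every site, by the
strong comparison principle, so it touches some member of this family from below. At a point of
contact cooperativity makes its velocity negative, although velocities on the circle are
nonnegative.
-/

namespace FK

open scoped Matrix

section Quasimonotone

/-- The Kamke condition for a vector field on `ι → ℝ`: the `i`-th component does not decrease when
coordinates other than the `i`-th increase. It is the cooperativity of the flow, stated so that it
applies to infinite configurations and to finite truncations alike. -/
def IsQuasimonotone {ι : Type*} (G : (ι → ℝ) → ι → ℝ) : Prop :=
  ∀ ⦃x y : ι → ℝ⦄, x ≤ y → ∀ ⦃i⦄, x i = y i → G x i ≤ G y i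

/-- The vector field `-∇W`, with components `-∂W/∂yᵢ`. For a truncated energy it is the gradient
vector field at the free sites. -/
noncomputable def negGradient {ι : Type*} [Fintype ι] [DecidableEq ι] (W : (ι → ℝ) → ℝ)
    (y : ι → ℝ) (i : ι) : ℝ :=
  -fderiv ℝ W y (Pi.single i 1)

theorem smul_abs_le_mulVec_abs {ι R : Type*} [Fintype ι] [CommRing R] [LinearOrder R]
    [IsStrictOrderedRing R] {A : Matrix ι ι R} (hA : ∀ i j, i ≠ j → 0 ≤ A i j) {μ : R}
    {u : ι → R} (hu : A *ᵥ u = μ • u) : μ • |u| ≤ A *ᵥ |u| := by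
  classical
  intro i
  have hi : A i i * u i + ∑ j ∈ Finset.univ.erase i, A i j * u j = μ * u i :=
    (Finset.add_sum_erase _ _ (Finset.mem_univ i)).trans (congrFun hu i)
  have hoff : (μ - A i i) * |u i| ≤ ∑ j ∈ Finset.univ.erase i, A i j * |u j| := calc
    (μ - A i i) * |u i| ≤ |μ - A i i| * |u i| := by gcongr; exact le_abs_self _
    _ = |∑ j ∈ Finset.univ.erase i, A i j * u j| := by
      rw [← abs_mul]; congr 1; linear_combination -hi
    _ ≤ ∑ j ∈ Finset.univ.erase i, |A i j * u j| := Finset.abs_sum_le_sum_abs _ _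
    _ = ∑ j ∈ Finset.univ.erase i, A i j * |u j| := Finset.sum_congr rfl fun j hj => by
      rw [abs_mul, abs_of_nonneg (hA i j (Finset.ne_of_mem_erase hj).symm)]
  calc μ * |u i| ≤ A i i * |u i| + ∑ j ∈ Finset.univ.erase i, A i j * |u j| := by
        linear_combination hoff
    _ = (A *ᵥ |u|) i := Finset.add_sum_erase _ (fun j => A i j * |u j|) (Finset.mem_univ i)

theorem exists_pos_smul_le_and_mul_eq {ι K : Type*} [Finite ι] [Field K] [LinearOrder K]
    [IsStrictOrderedRing K] {d v : ι → K} (hd : ∀ i, 0 < d i) (hv : ∃ k, 0 < v k) :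
    ∃ ε > 0, ε • v ≤ d ∧ ∃ n, ε * v n = d n := by
  have := Fintype.ofFinite ι
  obtain ⟨k, hk⟩ := hv
  obtain ⟨n, hn, hmin⟩ := (Finset.univ.filter fun i => 0 < v i).exists_min_image
    (fun i => d i / v i) ⟨k, by simpa using hk⟩
  simp only [Finset.mem_filter, Finset.mem_univ, true_and] at hn hmin
  have hε : 0 < d n / v n := div_pos (hd n) hn
  refine ⟨d n / v n, hε, fun i => ?_, n, div_mul_cancel₀ _ hn.ne'⟩
  rcases le_or_gt (v i) 0 with hi | hi
  · exact (mul_nonpos_of_nonneg_of_nonpos hε.le hi).trans (hd i).le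
  · exact (le_div_iff₀ hi).1 (hmin i hi)

theorem hasDerivAt_fderiv_comp_apply {E F : Type*} [NormedAddCommGroup E] [NormedSpace ℝ E]
    [NormedAddCommGroup F] [NormedSpace ℝ F] {f : E → F} (hf : ContDiff ℝ 2 f) {γ : ℝ → E}
    {v : E} {t : ℝ} (hγ : HasDerivAt γ v t) (w : E) :
    HasDerivAt (fun s => fderiv ℝ f (γ s) w) (fderiv ℝ (fderiv ℝ f) (γ t) v w) t := by
  have hf' : Differentiable ℝ (fderiv ℝ f) :=
    (hf.fderiv_right (m := 1) (by norm_num)).differentiable (by norm_num)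
  simpa using ((hf' (γ t)).hasFDerivAt.comp_hasDerivAt t hγ).clm_apply (hasDerivAt_const t w)

variable {ι : Type} [Fintype ι] [DecidableEq ι] {W : (ι → ℝ) → ℝ}

theorem hessian_apply (hW : ContDiff ℝ 2 W) (y : ι → ℝ) (i j : ι) :
    hessian W y i j = fderiv ℝ (fderiv ℝ W) y (Pi.single i 1) (Pi.single j 1) := by
  have hW' : Differentiable ℝ (fderiv ℝ W) :=
    (hW.fderiv_right (m := 1) (by norm_num)).differentiable (by norm_num)
  simp [hessian, fderiv_clm_apply (hW' y) (differentiableAt_const _)]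

theorem hessian_mulVec (hW : ContDiff ℝ 2 W) (y v : ι → ℝ) (i : ι) :
    (hessian W y *ᵥ v) i = fderiv ℝ (fderiv ℝ W) y v (Pi.single i 1) := by
  have hsymm : IsSymmSndFDerivAt ℝ W y := hW.contDiffAt.isSymmSndFDerivAt (by simp)
  rw [hsymm.eq, pi_eq_sum_univ' v, map_sum]
  simp [Matrix.mulVec, dotProduct, hessian_apply hW, mul_comm, Finset.sum_apply, Pi.single_apply]

theorem hasDerivAt_negGradient_line (hW : ContDiff ℝ 2 W) (y v : ι → ℝ) (i : ι) :
    HasDerivAt (fun t : ℝ => negGradient W (y + t • v) i) ((-hessian W y *ᵥ v) i) 0 := by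
  have hline : HasDerivAt (fun t : ℝ => y + t • v) v 0 := by
    simpa using ((hasDerivAt_id (0 : ℝ)).smul_const v).const_add y
  have hderiv := (hasDerivAt_fderiv_comp_apply hW hline (Pi.single i 1)).fun_neg
  rwa [zero_smul, add_zero, ← hessian_mulVec hW, ← Pi.neg_apply, ← Matrix.neg_mulVec] at hderiv

theorem IsQuasimonotone.neg_hessian_nonneg (hG : IsQuasimonotone (negGradient W))
    (hW : ContDiff ℝ 2 W) (y : ι → ℝ) {i j : ι} (hij : i ≠ j) : 0 ≤ (-hessian W y) i j := by
  have hmono : Monotone fun t : ℝ => negGradient W (y + t • Pi.single j 1) i := fun s t hst =>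
    hG (add_le_add_right (smul_le_smul_of_nonneg_right hst (Pi.single_nonneg.2 zero_le_one)) y)
      (by simp [hij])
  simpa [(hasDerivAt_negGradient_line hW y (Pi.single j 1) i).deriv] using
    hmono.deriv_nonneg (x := 0)

theorem eventually_negGradient_sub_smul_neg (hW : ContDiff ℝ 2 W) {y v : ι → ℝ}
    (hy : negGradient W y = 0) {i : ι} (hi : 0 < (-hessian W y *ᵥ v) i) :
    ∀ᶠ ε : ℝ in 𝓝[>] 0, negGradient W (y - ε • v) i < 0 := by
  have hderiv := hasDerivAt_negGradient_line hW y (-v) i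
  have hsign := eventually_nhdsWithin_sign_eq_of_deriv_neg
    (f := fun t : ℝ => negGradient W (y + t • -v) i) (x₀ := 0)
    (by rw [hderiv.deriv, Matrix.mulVec_neg]; exact neg_neg_of_pos hi) (by simp [hy])
  filter_upwards [nhdsWithin_le_nhds hsign, self_mem_nhdsWithin] with ε hε (hpos : 0 < ε)
  rwa [zero_sub, sign_neg (neg_neg_of_pos hpos), sign_eq_neg_one_iff, smul_neg,
    ← sub_eq_add_neg] at hε

theorem IsQuasimonotone.eventually_exists_negGradient_neg
    (hG : IsQuasimonotone (negGradient W)) (hW : ContDiff ℝ 2 W) {y : ι → ℝ}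
    (hy : negGradient W y = 0) {μ : ℝ} (hμ : 0 < μ)
    (hev : Module.End.HasEigenvalue (Matrix.toLin' (-hessian W y)) μ) :
    ∀ᶠ z in 𝓝 y, (∀ i, z i < y i) → ∃ i, negGradient W z i < 0 := by
  obtain ⟨u, hu⟩ := hev.exists_hasEigenvector
  have hexpand : μ • |u| ≤ -hessian W y *ᵥ |u| :=
    smul_abs_le_mulVec_abs (fun i j => hG.neg_hessian_nonneg hW y) hu.apply_eq_smul
  obtain ⟨k, hk⟩ : ∃ k, 0 < |u| k := (Function.ne_iff.1 hu.2).imp fun k => abs_pos.2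
  have hdown : ∀ᶠ ε : ℝ in 𝓝[>] 0, ∀ i, 0 < |u| i → negGradient W (y - ε • |u|) i < 0 :=
    Filter.eventually_all.2 fun i => Filter.eventually_imp_distrib_left.2 fun hi =>
      eventually_negGradient_sub_smul_neg hW hy ((mul_pos hμ hi).trans_le (hexpand i))
  obtain ⟨ε₀, hε₀, hdown⟩ := mem_nhdsGT_iff_exists_Ioo_subset.1 hdown
  have hnear : ∀ᶠ z in 𝓝 y, y k - ε₀ * |u| k < z k :=
    (continuous_apply k).continuousAt.eventually_const_lt (sub_lt_self _ (mul_pos hε₀ hk))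
  filter_upwards [hnear] with z hzk hzy
  obtain ⟨ε, hε, hle, n, hn⟩ :=
    exists_pos_smul_le_and_mul_eq (d := y - z) (fun i => sub_pos.2 (hzy i)) ⟨k, hk⟩
  have hεlt : ε < ε₀ := lt_of_mul_lt_mul_right
    ((hle k).trans_lt (sub_lt_comm.1 hzk)) hk.le
  have hun : 0 < |u| n := pos_of_mul_pos_right (hn ▸ sub_pos.2 (hzy n)) hε.le
  have htouch : z n = (y - ε • |u|) n := by
    rw [Pi.sub_apply, Pi.smul_apply, smul_eq_mul, hn, Pi.sub_apply, sub_sub_cancel]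
  exact ⟨n, (hG (le_sub_comm.1 hle) htouch).trans_lt (hdown ⟨hε, hεlt⟩ n hun)⟩

end Quasimonotone

section Twist

variable {h : ℝ → ℝ → ℝ} {F : ℝ} {x y : ℤ → ℝ}

theorem hasDerivAt_d1 (hh : Differentiable ℝ (Function.uncurry h)) (a b : ℝ) :
    HasDerivAt (fun u => h u b) (d1 h a b) a :=
  (hh.comp (differentiable_id.prodMk (differentiable_const b)) a).hasDerivAt

theorem hasDerivAt_d2 (hh : Differentiable ℝ (Function.uncurry h)) (a b : ℝ) :
    HasDerivAt (fun v => h a v) (d2 h a b) b :=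
  (hh.comp ((differentiable_const a).prodMk differentiable_id) b).hasDerivAt

theorem d1_eq_fderiv (hh : Differentiable ℝ (Function.uncurry h)) (a b : ℝ) :
    d1 h a b = fderiv ℝ (Function.uncurry h) (a, b) (1, 0) := by
  have hline : HasDerivAt (fun u : ℝ => (u, b)) (1, 0) a :=
    (hasDerivAt_id a).prodMk (hasDerivAt_const a b)
  exact ((hh (a, b)).hasFDerivAt.comp_hasDerivAt a hline).deriv

theorem d2_eq_fderiv (hh : Differentiable ℝ (Function.uncurry h)) (a b : ℝ) :
    d2 h a b = fderiv ℝ (Function.uncurry h) (a, b) (0, 1) := by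
  have hline : HasDerivAt (fun v : ℝ => (a, v)) (0, 1) b :=
    (hasDerivAt_const b a).prodMk (hasDerivAt_id b)
  exact ((hh (a, b)).hasFDerivAt.comp_hasDerivAt b hline).deriv

theorem deriv_d2_left (hh : ContDiff ℝ 2 (Function.uncurry h)) (a b : ℝ) :
    deriv (fun u => d2 h u b) a = d12 h a b := by
  have hdiff := hh.differentiable (by norm_num)
  have hsymm : IsSymmSndFDerivAt ℝ (Function.uncurry h) (a, b) :=
    hh.contDiffAt.isSymmSndFDerivAt (by simp)
  simp only [d12, d1_eq_fderiv hdiff, d2_eq_fderiv hdiff]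
  rw [(hasDerivAt_fderiv_comp_apply hh
      ((hasDerivAt_id' a).prodMk (hasDerivAt_const a b)) (0, 1)).deriv,
    (hasDerivAt_fderiv_comp_apply hh
      ((hasDerivAt_const b a).prodMk (hasDerivAt_id' b)) (1, 0)).deriv, hsymm.eq]

theorem strictAnti_d1 (htwist : ∀ a b, d12 h a b < 0) (a : ℝ) : StrictAnti fun v => d1 h a v :=
  strictAnti_of_deriv_neg fun b => htwist a b

theorem strictAnti_d2 (hh : ContDiff ℝ 2 (Function.uncurry h)) (htwist : ∀ a b, d12 h a b < 0)
    (b : ℝ) : StrictAnti fun u => d2 h u b :=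
  strictAnti_of_deriv_neg fun a => (deriv_d2_left hh a b).trans_lt (htwist a b)

theorem isQuasimonotone_vectorField (hh : ContDiff ℝ 2 (Function.uncurry h))
    (htwist : ∀ a b, d12 h a b < 0) (F : ℝ) : IsQuasimonotone (vectorField h F) := by
  intro x y hxy n hn
  have hright := (strictAnti_d1 htwist (y n)).antitone (hxy (n + 1))
  have hleft := (strictAnti_d2 hh htwist (y n)).antitone (hxy (n - 1))
  simp only [vectorField, hn]
  linarith

theorem eq_neighbours_of_vectorField_le (hh : ContDiff ℝ 2 (Function.uncurry h))
    (htwist : ∀ a b, d12 h a b < 0) (hxy : x ≤ y) {n : ℤ}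
    (hv : vectorField h F y n ≤ vectorField h F x n) (hn : x n = y n) :
    x (n - 1) = y (n - 1) ∧ x (n + 1) = y (n + 1) := by
  have hright := (strictAnti_d1 htwist (y n)).antitone (hxy (n + 1))
  have hleft := (strictAnti_d2 hh htwist (y n)).antitone (hxy (n - 1))
  simp only [vectorField, hn] at hv hright hleft
  exact ⟨(strictAnti_d2 hh htwist (y n)).injective (hleft.antisymm' (by linarith)),
    (strictAnti_d1 htwist (y n)).injective (hright.antisymm' (by linarith))⟩

theorem apply_lt_of_vectorField_le (hh : ContDiff ℝ 2 (Function.uncurry h))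
    (htwist : ∀ a b, d12 h a b < 0) (hxy : x < y) (hv : vectorField h F y ≤ vectorField h F x)
    (n : ℤ) : x n < y n := by
  refine (hxy.le n).lt_of_ne fun hn => hxy.ne (funext fun k => ?_)
  induction k using Int.inductionOn' (b := n) with
  | zero => exact hn
  | succ k _ ih => exact (eq_neighbours_of_vectorField_le hh htwist hxy.le (hv k) ih).2
  | pred k _ ih => exact (eq_neighbours_of_vectorField_le hh htwist hxy.le (hv k) ih).1

theorem IsEquilibrium.vectorField_eq_zero (hx : IsEquilibrium h F x) : vectorField h F x = 0 := by
  funext n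
  simp only [vectorField, Pi.zero_apply]
  linarith [hx n]

end Twist

section TruncatedEnergy

variable {h : ℝ → ℝ → ℝ} {F : ℝ} {x : ℤ → ℝ} {l m : ℤ}

theorem glue_coe (x : ℤ → ℝ) (y : Finset.Ioo l m → ℝ) (i : Finset.Ioo l m) :
    glue x l m y i = y i := by
  simp [glue]

theorem glue_self (x : ℤ → ℝ) (l m : ℤ) : glue x l m (fun i => x i) = x := by
  funext i
  simp [glue]

theorem glue_mono {x' : ℤ → ℝ} (hx : x ≤ x') {y y' : Finset.Ioo l m → ℝ} (hy : y ≤ y') :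
    glue x l m y ≤ glue x' l m y' := by
  intro i
  unfold glue
  split_ifs with hi
  exacts [hy ⟨i, hi⟩, hx i]

theorem glue_update (x : ℤ → ℝ) (y : Finset.Ioo l m → ℝ) (j : Finset.Ioo l m) (t : ℝ) :
    glue x l m (Function.update y j t) = Function.update (glue x l m y) j t := by
  funext i
  by_cases hij : i = j
  · subst hij
    simp [glue_coe]
  · by_cases hi : i ∈ Finset.Ioo l m
    · simp [glue, hi, hij, Subtype.ext_iff]
    · simp only [glue, dif_neg hi, Function.update_of_ne hij]

theorem contDiff_glue_apply {n : WithTop ℕ∞} (x : ℤ → ℝ) (l m i : ℤ) :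
    ContDiff ℝ n fun y => glue x l m y i := by
  by_cases hi : i ∈ Finset.Ioo l m
  · simpa only [glue, dif_pos hi] using contDiff_apply ℝ ℝ _
  · simpa only [glue, dif_neg hi] using contDiff_const

theorem contDiff_truncatedEnergy {n : WithTop ℕ∞} (hh : ContDiff ℝ n (Function.uncurry h))
    (F : ℝ) (x : ℤ → ℝ) (l m : ℤ) : ContDiff ℝ n (truncatedEnergy h F x l m) :=
  ContDiff.sum fun i _ =>
    (hh.comp ((contDiff_glue_apply x l m i).prodMk (contDiff_glue_apply x l m (i + 1)))).sub
      (contDiff_const.mul (contDiff_glue_apply x l m i))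

theorem hasDerivAt_tilted_update (hh : Differentiable ℝ (Function.uncurry h)) (F : ℝ)
    (x : ℤ → ℝ) (i j : ℤ) :
    HasDerivAt
      (fun t => tilted h F (Function.update x j t i) (Function.update x j t (i + 1)))
      ((if i = j then d1 h (x j) (x (j + 1)) - F else 0) +
        if i = j - 1 then d2 h (x (j - 1)) (x j) else 0) (x j) := by
  rcases eq_or_ne i j with rfl | hij
  · have hpred : i ≠ i - 1 := by omega
    simpa [tilted, hpred] using
      (hasDerivAt_d1 hh (x i) (x (i + 1))).fun_sub ((hasDerivAt_id' (x i)).const_mul F)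
  rcases eq_or_ne i (j - 1) with rfl | hij'
  · simpa [tilted] using (hasDerivAt_d2 hh (x (j - 1)) (x j)).sub_const (F * x (j - 1))
  · have hsucc : i + 1 ≠ j := by omega
    simpa [hij, hij', hsucc] using hasDerivAt_const (x j) _

theorem negGradient_truncatedEnergy (hh : ContDiff ℝ 1 (Function.uncurry h)) (F : ℝ)
    (x : ℤ → ℝ) (l m : ℤ) (y : Finset.Ioo l m → ℝ) (j : Finset.Ioo l m) :
    negGradient (truncatedEnergy h F x l m) y j = vectorField h F (glue x l m y) j := by
  obtain ⟨hlj, hjm⟩ := Finset.mem_Ioo.1 j.2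
  have hW := (contDiff_truncatedEnergy hh F x l m).differentiable one_ne_zero
  have hchain := (hW (Function.update y j (y j))).hasFDerivAt.comp_hasDerivAt (y j)
    (hasDerivAt_update y j (y j))
  have hsum := HasDerivAt.fun_sum (u := Finset.Ico l m) fun i _ =>
    hasDerivAt_tilted_update (hh.differentiable one_ne_zero) F (glue x l m y) i j
  rw [Finset.sum_add_distrib, Finset.sum_ite_eq', Finset.sum_ite_eq',
    if_pos (Finset.mem_Ico.2 ⟨hlj.le, hjm⟩), if_pos (Finset.mem_Ico.2 (by omega)),
    glue_coe] at hsum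
  simp only [← glue_update] at hsum
  have hfderiv := hchain.unique hsum
  rw [Function.update_eq_self] at hfderiv
  rw [negGradient, hfderiv, vectorField, glue_coe]
  ring

theorem isQuasimonotone_negGradient_truncatedEnergy (hh : ContDiff ℝ 2 (Function.uncurry h))
    (htwist : ∀ a b, d12 h a b < 0) (F : ℝ) (x : ℤ → ℝ) (l m : ℤ) :
    IsQuasimonotone (negGradient (truncatedEnergy h F x l m)) := by
  intro y y' hy i hi
  simp only [negGradient_truncatedEnergy (hh.of_le one_le_two)]
  exact isQuasimonotone_vectorField hh htwist F (glue_mono le_rfl hy) (by simpa only [glue_coe])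

theorem not_hasPositiveMorseIndex_of_mem_closure (hh : ContDiff ℝ 2 (Function.uncurry h))
    (htwist : ∀ a b, d12 h a b < 0) {S : Set (ℤ → ℝ)}
    (hpos : ∀ z ∈ S, ∀ n, 0 ≤ vectorField h F z n) (hx : IsEquilibrium h F x)
    (hcl : x ∈ closure (S ∩ Set.Iio x)) (l m : ℤ) : ¬ HasPositiveMorseIndex h F x l m := by
  rintro ⟨μ, hμ, hev⟩
  have hgrad := negGradient_truncatedEnergy (hh.of_le one_le_two) F x l m
  have hcrit : negGradient (truncatedEnergy h F x l m) (fun i => x i) = 0 := by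
    funext i
    rw [hgrad, glue_self, hx.vectorField_eq_zero, Pi.zero_apply, Pi.zero_apply]
  have hnear := (isQuasimonotone_negGradient_truncatedEnergy hh htwist F x l m)
    |>.eventually_exists_negGradient_neg (contDiff_truncatedEnergy hh F x l m) hcrit hμ hev
  have hrestrict : Continuous fun (z : ℤ → ℝ) (i : Finset.Ioo l m) => z i :=
    continuous_pi fun i => continuous_apply _
  obtain ⟨z, ⟨hzS, hzx⟩, hz⟩ := ((mem_closure_iff_frequently.1 hcl).and_eventually
    ((hrestrict.tendsto x).eventually hnear)).exists
  obtain ⟨i, hi⟩ := hz fun i => apply_lt_of_vectorField_le hh htwist hzx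
    (hx.vectorField_eq_zero.trans_le (hpos z hzS)) i
  have hcomp : vectorField h F z i ≤ vectorField h F (glue x l m fun i => z i) i :=
    isQuasimonotone_vectorField hh htwist F
      ((glue_self z l m).ge.trans (glue_mono hzx.le le_rfl)) (glue_coe x (fun i => z i) i).symm
  rw [hgrad] at hi
  exact ((hpos z hzS i).trans hcomp).not_gt hi

end TruncatedEnergy

section OrderedCircle

theorem weightedTerm_nonneg (x : ℤ → ℝ) (n : ℤ) : 0 ≤ weightedTerm x n := by
  unfold weightedTerm
  positivity

theorem sub_mem_X {x y : ℤ → ℝ} (hx : x ∈ X) (hy : y ∈ X) : x - y ∈ X := by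
  refine Summable.of_nonneg_of_le (weightedTerm_nonneg _) (fun n => ?_) (hx.add hy)
  simp only [weightedTerm, Pi.sub_apply, ← mul_add]
  gcongr
  exact abs_sub _ _

theorem abs_apply_le_weightedNorm {x : ℤ → ℝ} (hx : x ∈ X) (n : ℤ) :
    |x n| ≤ 2 ^ n.natAbs * weightedNorm x := calc
  |x n| = 2 ^ n.natAbs * weightedTerm x n := by
    rw [weightedTerm, ← mul_assoc, ← mul_pow]
    norm_num
  _ ≤ 2 ^ n.natAbs * weightedNorm x := by
    gcongr
    exact hx.le_tsum n fun k _ => weightedTerm_nonneg x k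

theorem tendsto_of_tendsto_weightedNorm {α : Type*} {f : Filter α} {y : α → ℤ → ℝ}
    {x : ℤ → ℝ} (hy : ∀ a, y a ∈ X) (hx : x ∈ X)
    (ht : Tendsto (fun a => weightedNorm (y a - x)) f (𝓝 0)) : Tendsto y f (𝓝 x) := by
  refine tendsto_pi_nhds.2 fun n => tendsto_iff_norm_sub_tendsto_zero.2 ?_
  refine squeeze_zero (fun a => norm_nonneg _)
    (fun a => abs_apply_le_weightedNorm (sub_mem_X (hy a) hx) n) ?_
  simpa using ht.const_mul (2 ^ n.natAbs : ℝ)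

theorem IsOrderedCircle.mem_closure_inter_Iio {ℓ : Set (ℤ → ℝ)} (hℓ : IsOrderedCircle ℓ)
    {x : ℤ → ℝ} (hx : x ∈ ℓ) : x ∈ closure (ℓ ∩ Set.Iio x) := by
  obtain ⟨τ, hX, hcont, hmono, -, rfl⟩ := hℓ
  obtain ⟨s, rfl⟩ := hx
  refine mem_closure_of_tendsto (b := 𝓝[<] s)
    ((tendsto_of_tendsto_weightedNorm hX (hX s) (hcont s)).mono_left nhdsWithin_le_nhds) ?_
  filter_upwards [self_mem_nhdsWithin] with s' hs'
  exact ⟨⟨s', rfl⟩, hmono s' s hs'⟩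

end OrderedCircle

end FK

theorem mainTheorem8_general {h : ℝ → ℝ → ℝ} (hh : ContDiff ℝ 2 (Function.uncurry h))
    (htwist : ∀ a b, FK.d12 h a b < 0) {F : ℝ} {ℓ : Set (ℤ → ℝ)} (hℓ : FK.IsOrderedCircle ℓ)
    (hpos : ∀ z ∈ ℓ, ∀ n : ℤ, 0 ≤ FK.vectorField h F z n) {x : ℤ → ℝ} (hx : x ∈ ℓ)
    (heq : FK.IsEquilibrium h F x) (l m : ℤ) : ¬ FK.HasPositiveMorseIndex h F x l m :=
  FK.not_hasPositiveMorseIndex_of_mem_closure hh htwist hpos heq (hℓ.mem_closure_inter_Iio hx) l m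

theorem mainTheorem8 (h : ℝ → ℝ → ℝ) (hh : FK.IsEnergy h)
    (p : ℤ) (q : ℕ) (hq : 0 < q) (hpq : IsCoprime p (q : ℤ))
    (F : ℝ)
    (hF₁ : FK.depinningForcePlus h ((p : ℝ) / q) ≤ F)
    (hF₂ : F < FK.depinningForce h ((p : ℝ) / q))
    (ℓ : Set (ℤ → ℝ)) (hℓ : FK.IsIOCPlus h F p q ℓ)
    (hpos : ∀ z ∈ ℓ, ∀ n : ℤ, 0 ≤ FK.vectorField h F z n) :
    ∀ x ∈ ℓ, FK.IsEquilibriumPlus h F p q x →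
      ∀ l m : ℤ, l < m - 1 → ¬ FK.HasPositiveMorseIndex h F x l m := by
  intro x hx hxe l m _
  obtain ⟨c, hc, htwist⟩ := hh.twist
  exact mainTheorem8_general hh.contDiff (fun a b => (htwist a b).trans_lt (neg_neg_of_pos hc))
    hℓ.1.1.1 hpos hx hxe.2.1 l m
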